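/- Let $k$ be an algebraically closed field of characteristic $p>0$, let $X$ be a projective variety (irreducible and reduced) over $k$, let $L$ be an ample line bundle on $X$, and let $Z$ be a finite set of smooth closed points of $X$, with the reduced scheme structure and ideal sheaf $I_Z$. For $q=p^e$ let $I_Z^{[q]}$ be the ideal sheaf locally generated by the $q$-th powers of the local sections of $I_Z$. For $e\ge 1$, a line bundle $A$ on $X$ is said to separate $p^e$-Frobenius jets at $Z$ if the restriction map $$H^0(X,A)\longrightarrow H^0\bigl(X,A\otimes\mathcal O_X/I_Z^{[p^e]}\bigr)$$ is surjective. Let $s_F(A;Z)\in\mathbb Z_{\ge 0}\cup\{\infty\}$ be the largest $e\ge 1$ such that $A$ separates $p^e$-Frobenius jets at $Z$, with $s_F(A;Z)=0$ if there is no such $e$ and $s_F(A;Z)=\infty$ if there are arbitrarily large such $e$. Let $m$ and $r$ be positive integers, suppose that $e=s_F(L^m;Z)$ is finite, and let $d_r=\frac{p^{re}-1}{p^e-1}$ (if $e=0$, put $d_r=0$; the assertion is then trivial). Then $$s_F\bigl(L^{md_r};Z\bigr)\ \ge\ re,$$ and, if $e\ge 1$, the line bundle $L^{md_r}$ separates $p^{re}$-Frobenius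 jets at $Z$. -/

import Mathlib

open CategoryTheory AlgebraicGeometry TopologicalSpace Opposite

universe u

noncomputable section

namespace FrobeniusSeshadri

/-! ### Line bundles on schemes and their tensor powers -/

section LineBundles

variable {X : Scheme.{u}}

/-- A section `t` of the sheaf of modules `M` over `U` is a local frame if `r ↦ r • t` is an
isomorphism from the restriction of the structure sheaf to `U` onto the restriction of `M`
to `U`. -/
def IsFrame (M : X.Modules) {U : X.Opens} (t : Γ(M, U)) : Prop :=
  ∀ (V : X.Opens) (hV : V ≤ U),
    Function.Bijective fun r : Γ(X, V) ↦ r • M.presheaf.map (homOfLE hV).op t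

/-- A line bundle (invertible sheaf): a sheaf of modules that is locally isomorphic to the
structure sheaf. -/
def IsLineBundle (M : X.Modules) : Prop :=
  ∀ x : X, ∃ (U : X.Opens) (t : Γ(M, U)), x ∈ U ∧ IsFrame M t

/-- The structure sheaf, as a sheaf of modules over itself. -/
def structureModule (X : Scheme.{u}) : X.Modules :=
  SheafOfModules.unit X.ringCatSheaf

/-- Presheaves of modules over the structure presheaf of commutative rings; these have a tensor
product, computed on each open set. -/
abbrev CommPresheafOfModules (X : Scheme.{u}) :=
  PresheafOfModules.{u} (X.presheaf ⋙ forget₂ CommRingCat.{u} RingCat.{u})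

/-- The presheaf of modules underlying a sheaf of modules. -/
def underlyingPresheaf (M : X.Modules) : CommPresheafOfModules X :=
  M.val

/-- The presheaf tensor product `U ↦ M(U) ⊗ N(U)` over the structure sheaf. -/
def presheafTensor (M N : X.Modules) : CommPresheafOfModules X :=
  MonoidalCategoryStruct.tensorObj (underlyingPresheaf M) (underlyingPresheaf N)

/-- The identity of the structure presheaf, seen as a map to the structure sheaf. -/
def structureMap (X : Scheme.{u}) :
    X.presheaf ⋙ forget₂ CommRingCat.{u} RingCat.{u} ⟶ X.ringCatSheaf.obj :=
  𝟙 X.ringCatSheaf.obj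

instance : IsIso (structureMap X) :=
  inferInstanceAs (IsIso (𝟙 X.ringCatSheaf.obj))

/-- The tensor product of two sheaves of modules over the structure sheaf: the sheaf associated
to the presheaf tensor product. -/
def tensor (M N : X.Modules) : X.Modules :=
  (PresheafOfModules.sheafification (structureMap X)).obj (presheafTensor M N)

/-- For sections `s` of `M` and `t` of `N` over `U`, the section `s ⊗ t` of `M ⊗ N` over `U`. -/
def tensorSection {M N : X.Modules} {U : X.Opens} (s : Γ(M, U)) (t : Γ(N, U)) :
    Γ(tensor M N, U) :=
  (((PresheafOfModules.sheafificationAdjunction (structureMap X)).unit.app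
    (presheafTensor M N)).app (op U)).hom
      (TensorProduct.tmul (X.presheaf.obj (op U)) (M := (underlyingPresheaf M).obj (op U))
        (N := (underlyingPresheaf N).obj (op U)) s t)

/-- The tensor power `M ^ n` of a sheaf of modules. -/
def tensorPow (M : X.Modules) : ℕ → X.Modules
  | 0 => structureModule X
  | n + 1 => tensor (tensorPow M n) M

/-- The open set `X_s` of points at which the global section `s` generates the sheaf `M`. -/
def generatingLocus (M : X.Modules) (s : Γ(M, ⊤)) : X.Opens :=
  sSup {U | IsFrame M (M.presheaf.map (homOfLE (le_top : U ≤ ⊤)).op s)}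

/-- Ampleness of a line bundle on a (quasi-compact) scheme: every point lies in an affine open
set of the form `X_s`, where `s` is a global section of some positive tensor power. -/
def IsAmple (L : X.Modules) : Prop :=
  ∀ x : X, ∃ (n : ℕ) (s : Γ(tensorPow L n, ⊤)), 1 ≤ n ∧
    x ∈ generatingLocus (tensorPow L n) s ∧ IsAffineOpen (generatingLocus (tensorPow L n) s)

end LineBundles

/-! ### Projective schemes and smooth points -/

section Varieties

variable {k : Type u} [Field k] {X : Scheme.{u}}

attribute [local instance] MvPolynomial.gradedAlgebra

/-- Projective `n`-space over `k`, as `Proj k[x₀, …, xₙ]`. -/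
def projectiveSpace (k : Type u) [Field k] (n : ℕ) : Scheme.{u} :=
  Proj (MvPolynomial.homogeneousSubmodule (Fin (n + 1)) k)

/-- The structure morphism of projective space. -/
def projectiveSpaceStr (k : Type u) [Field k] (n : ℕ) :
    projectiveSpace k n ⟶ Spec (CommRingCat.of k) :=
  Proj.toSpecZero (MvPolynomial.homogeneousSubmodule (Fin (n + 1)) k) ≫
    Spec.map (CommRingCat.ofHom
      (algebraMap k (MvPolynomial.homogeneousSubmodule (Fin (n + 1)) k 0)))

/-- A `k`-scheme is projective if it is isomorphic over `k` to a closed subscheme of some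
projective space. -/
def IsProjective (f : X ⟶ Spec (CommRingCat.of k)) : Prop :=
  ∃ (n : ℕ) (i : X ⟶ projectiveSpace k n), IsClosedImmersion i ∧ i ≫ projectiveSpaceStr k n = f

/-- The `k`-scheme `X` is smooth at the point `x`. -/
def IsSmoothAt (f : X ⟶ Spec (CommRingCat.of k)) (x : X) : Prop :=
  ∃ U : X.Opens, x ∈ U ∧ Smooth (U.ι ≫ f)

end Varieties

/-! ### Frobenius powers of ideal sheaves and separation of Frobenius jets -/

section Frobenius

variable {X : Scheme.{u}}

/-- The ideal generated by the `q`-th powers of the elements of an ideal. In characteristic `p`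
and for `q` a power of `p`, it is generated by the `q`-th powers of any generators of the
ideal. -/
def idealFrobPow {R : Type u} [CommRing R] (I : Ideal R) (q : ℕ) : Ideal R :=
  Ideal.span ((fun h : R ↦ h ^ q) '' (I : Set R))

/-- The ideals generated by `q`-th powers are compatible with localization at one element. -/
theorem map_idealFrobPow {R S : Type u} [CommRing R] [CommRing S] [Algebra R S] (f : R)
    [IsLocalization.Away f S] (I : Ideal R) (q : ℕ) :
    (idealFrobPow I q).map (algebraMap R S) = idealFrobPow (I.map (algebraMap R S)) q := by
  apply le_antisymm
  · rw [idealFrobPow, Ideal.map_span, Ideal.span_le]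
    rintro _ ⟨_, ⟨h, hh, rfl⟩, rfl⟩
    exact Ideal.subset_span ⟨algebraMap R S h, Ideal.mem_map_of_mem _ hh, (map_pow _ _ _).symm⟩
  · rw [idealFrobPow, Ideal.span_le]
    rintro _ ⟨y, hy, rfl⟩
    obtain ⟨⟨a, s⟩, has⟩ := (IsLocalization.mem_map_algebraMap_iff (Submonoid.powers f) S).1 hy
    have hu : IsUnit (algebraMap R S (s : R) ^ q) := (IsLocalization.map_units S s).pow q
    rw [SetLike.mem_coe, ← Ideal.mul_unit_mem_iff_mem _ hu]
    have h1 : y ^ q * algebraMap R S (s : R) ^ q = algebraMap R S ((a : R) ^ q) := by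
      rw [← mul_pow, has, map_pow]
    change y ^ q * algebraMap R S (s : R) ^ q ∈ _
    rw [h1]
    exact Ideal.mem_map_of_mem _ (Ideal.subset_span ⟨a, a.2, rfl⟩)

/-- The Frobenius power `J^{[q]}` of a quasi-coherent ideal sheaf: on an affine open set it is
generated by the `q`-th powers of the sections of `J`. -/
def frobPow (J : X.IdealSheafData) (q : ℕ) : X.IdealSheafData where
  ideal U := idealFrobPow (J.ideal U) q
  map_ideal_basicOpen U f := by
    let : Algebra Γ(X, U) Γ(X, X.affineBasicOpen f) :=
      (X.presheaf.map (homOfLE <| X.basicOpen_le f).op).hom.toAlgebra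
    have : IsLocalization.Away f Γ(X, X.affineBasicOpen f) :=
      U.2.isLocalization_of_eq_basicOpen _ _ rfl
    rw [← J.map_ideal_basicOpen U f]
    exact map_idealFrobPow (S := Γ(X, X.affineBasicOpen f)) f (J.ideal U) q

/-- The sheaf of modules `𝒪_X / J`: the push-forward to `X` of the structure sheaf of the closed
subscheme defined by `J`. -/
def quotientModule (J : X.IdealSheafData) : X.Modules :=
  (Scheme.Modules.pushforward J.subschemeι).obj (structureModule J.subscheme)

/-- The global section `1` of `𝒪_X / J`. -/
def quotientModuleOne (J : X.IdealSheafData) : Γ(quotientModule J, ⊤) :=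
  (1 : Γ(J.subscheme, J.subschemeι ⁻¹ᵁ ⊤))

/-- The restriction map `H⁰(X, A) → H⁰(X, A ⊗ 𝒪_X / J)`, `s ↦ s ⊗ 1`. -/
def restrictionMap (A : X.Modules) (J : X.IdealSheafData) (s : Γ(A, ⊤)) :
    Γ(tensor A (quotientModule J), ⊤) :=
  tensorSection s (quotientModuleOne J)

/-- `A` separates `q`-Frobenius jets at the closed subset `Z` with its reduced structure: the
restriction map `H⁰(X, A) → H⁰(X, A ⊗ 𝒪_X / I_Z^{[q]})` is surjective. -/
def SeparatesFrobeniusJets (A : X.Modules) (Z : Closeds X) (q : ℕ) : Prop :=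
  Function.Surjective
    (restrictionMap A (frobPow (Scheme.IdealSheafData.vanishingIdeal Z) q))

/-- The largest `e ≥ 1` such that `A` separates `p ^ e`-Frobenius jets at `Z`, with value `0` if
there is no such `e`, and value `⊤` if there are arbitrarily large ones. -/
def frobeniusJetOrder (p : ℕ) (A : X.Modules) (Z : Closeds X) : ℕ∞ :=
  ⨆ e ∈ {e : ℕ | 1 ≤ e ∧ SeparatesFrobeniusJets A Z (p ^ e)}, (e : ℕ∞)

end Frobenius

end FrobeniusSeshadri

end

/-!
Let `Q = p ^ i` and suppose that `L ^ m` separates `q`-jets and `L ^ n` separates `Q`-jets at `Z`.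
For sections `s` of `L ^ m` and `t` of `L ^ n`, the product `s ^ Q * t` is a section of
`L ^ (m * Q + n)`, and sums of such products generate all `q * Q`-jets
(`SeparatesFrobeniusJets.mul`). With `q = p ^ e`, `m` fixed and `Q = p ^ (r * e)` this gives the
theorem by induction on `r`, because `1 + p ^ e + ⋯ + p ^ (r * e)` is the quotient in the
statement.

The algebraic reason is `exists_sub_mem_idealFrobPow_mul`. Let `R` be the product, over the points
of `Z`, of the rings of small affine neighbourhoods, and `I` the ideal of `Z`. Consider
`g * h ^ Q` with `h ∈ I ^ j`. Replacing `h` by a section of `L ^ m` changes `h ^ Q` by an element of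
`I^{[q Q]}`, as `Q` is a power of the characteristic. Replacing `g` by a section of `L ^ n` changes
the element by a sum of terms `g' * (h * h') ^ Q` with `h' ∈ I`. After finitely many steps the
power of `I` that contains `h` lies in `I^{[q]}`, and the remaining error lies in `I^{[q Q]}`.

To reach this ring, sections of line bundles are written as families of functions in local frames
(`exists_section_iff`). The sheaf tensor product with a line bundle is computed by
`bijective_tensorSection`, which says that tensoring with a frame `t` of `M` is a bijection from
sections of `N` to sections of `M ⊗ N`. Since `Z` is discrete, a section of `A ⊗ 𝒪_X / I_Z^{[q]}` is
an independent choice of classes near the points of `Z`; `separatesFrobeniusJets_iff` expresses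
the surjectivity of the restriction map in these terms.
-/

noncomputable section

namespace FrobeniusSeshadri

/-! ### Sections of sheaves of modules and of tensor products -/

section SheafOfModules

variable {X : Scheme.{u}}

/-- Restriction of sections of a sheaf of modules to a smaller open set. -/
def res (M : X.Modules) {V U : X.Opens} (h : V ≤ U) : Γ(M, U) →+ Γ(M, V) :=
  (M.presheaf.map (homOfLE h).op).hom

/-- Restriction of regular functions to a smaller open set. -/
def resFun {V U : X.Opens} (h : V ≤ U) : Γ(X, U) →+* Γ(X, V) :=
  (X.presheaf.map (homOfLE h).op).hom

lemma res_smul (M : X.Modules) {V U : X.Opens} (h : V ≤ U) (r : Γ(X, U)) (s : Γ(M, U)) :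
    res M h (r • s) = resFun h r • res M h s :=
  M.map_smul (homOfLE h) r s

lemma res_res (M : X.Modules) {W V U : X.Opens} (h : V ≤ U) (h' : W ≤ V) (s : Γ(M, U)) :
    res M h' (res M h s) = res M (h'.trans h) s := by
  simp only [res]
  rw [← AddCommGrpCat.comp_apply, ← Functor.map_comp]
  rfl

lemma res_self (M : X.Modules) {U : X.Opens} (s : Γ(M, U)) : res M le_rfl s = s := by
  have : (homOfLE (le_refl U)) = 𝟙 U := rfl
  simp only [res, this, op_id, CategoryTheory.Functor.map_id]
  rfl

lemma isFrame_iff (M : X.Modules) {U : X.Opens} (t : Γ(M, U)) :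
    IsFrame M t ↔ ∀ (V : X.Opens) (hV : V ≤ U),
      Function.Bijective fun r : Γ(X, V) ↦ r • res M hV t :=
  Iff.rfl

lemma section_ext (M : X.Modules) {U : X.Opens} {s s' : Γ(M, U)}
    (h : ∀ x ∈ U, ∃ (V : X.Opens) (hV : V ≤ U), x ∈ V ∧ res M hV s = res M hV s') : s = s' := by
  choose V hV hx he using h
  refine TopCat.Sheaf.eq_of_locally_eq' ⟨M.presheaf, M.isSheaf⟩ (fun x : U ↦ V x.1 x.2) U
    (fun x ↦ homOfLE (hV x.1 x.2)) ?_ s s' (fun x ↦ he x.1 x.2)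
  intro x hxU
  exact Opens.mem_iSup.2 ⟨⟨x, hxU⟩, hx x hxU⟩

lemma exists_glue (M : X.Modules) {ι : Type u} {U : X.Opens} (V : ι → X.Opens) (hV : ∀ i, V i ≤ U)
    (hcov : ∀ x ∈ U, ∃ i, x ∈ V i) (s : ∀ i, Γ(M, V i))
    (hs : ∀ i j, res M (inf_le_left : V i ⊓ V j ≤ V i) (s i) = res M inf_le_right (s j)) :
    ∃ σ : Γ(M, U), ∀ i, res M (hV i) σ = s i := by
  obtain ⟨σ, hσ, -⟩ := TopCat.Sheaf.existsUnique_gluing' ⟨M.presheaf, M.isSheaf⟩ V U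
    (fun i ↦ homOfLE (hV i)) (fun x hxU ↦ Opens.mem_iSup.2 (hcov x hxU)) s hs
  exact ⟨σ, hσ⟩

end SheafOfModules

section Tensor

variable {X : Scheme.{u}} {M N : X.Modules}

/-- The sections of the presheaf tensor product over `U`. -/
abbrev PreTensor (M N : X.Modules) (U : X.Opens) : Type u :=
  TensorProduct (X.presheaf.obj (op U)) ((underlyingPresheaf M).obj (op U))
    ((underlyingPresheaf N).obj (op U))

/-- The map from sections of the presheaf tensor product to sections of the associated sheaf. -/
def toTensor (M N : X.Modules) (U : X.Opens) : PreTensor M N U →+ Γ(tensor M N, U) :=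
  ((((PresheafOfModules.sheafificationAdjunction (structureMap X)).unit.app
    (presheafTensor M N)).app (op U)).hom).toAddMonoidHom

/-- The pure tensor of two sections, in the presheaf tensor product. -/
def pureTensor {U : X.Opens} (s : Γ(M, U)) (t : Γ(N, U)) : PreTensor M N U :=
  TensorProduct.tmul (X.presheaf.obj (op U)) (M := (underlyingPresheaf M).obj (op U))
        (N := (underlyingPresheaf N).obj (op U)) s t

lemma toTensor_pureTensor {U : X.Opens} (s : Γ(M, U)) (t : Γ(N, U)) :
    toTensor M N U (pureTensor s t) = tensorSection s t := rfl

/-- Restriction in the presheaf tensor product. -/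
def preRes (M N : X.Modules) {V U : X.Opens} (h : V ≤ U) : PreTensor M N U →+ PreTensor M N V :=
  (((PresheafOfModules.toPresheaf _).obj (presheafTensor M N)).map (homOfLE h).op).hom

lemma preRes_pureTensor {V U : X.Opens} (h : V ≤ U) (s : Γ(M, U)) (t : Γ(N, U)) :
    preRes M N h (pureTensor s t) = pureTensor (res M h s) (res N h t) := rfl

lemma res_toTensor {V U : X.Opens} (h : V ≤ U) (τ : PreTensor M N U) :
    res (tensor M N) h (toTensor M N U τ) = toTensor M N V (preRes M N h τ) := by
  have := NatTrans.naturality_apply (toSheafify (Opens.grothendieckTopology X)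
    (presheafTensor M N).presheaf) (homOfLE h).op τ
  exact this.symm

/-- Sections of `M ⊗ N` come locally from the presheaf tensor product. -/
lemma exists_toTensor_eq {U : X.Opens} (σ : Γ(tensor M N, U)) (x : X) (hx : x ∈ U) :
    ∃ (V : X.Opens) (hV : V ≤ U), x ∈ V ∧
      ∃ τ : PreTensor M N V, toTensor M N V τ = res (tensor M N) hV σ := by
  have := Presheaf.imageSieve_mem (Opens.grothendieckTopology X)
    (toSheafify (Opens.grothendieckTopology X) (presheafTensor M N).presheaf) (U := op U) σ
  obtain ⟨V, f, ⟨τ, hτ⟩, hxV⟩ := this x hx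
  exact ⟨V, f.le, hxV, τ, hτ⟩

/-- Elements of the presheaf tensor product with the same image in `M ⊗ N` agree locally. -/
lemma exists_preRes_eq {U : X.Opens} (τ τ' : PreTensor M N U)
    (h : toTensor M N U τ = toTensor M N U τ') (x : X) (hx : x ∈ U) :
    ∃ (V : X.Opens) (hV : V ≤ U), x ∈ V ∧ preRes M N hV τ = preRes M N hV τ' := by
  have := Presheaf.equalizerSieve_mem (Opens.grothendieckTopology X)
    (toSheafify (Opens.grothendieckTopology X) (presheafTensor M N).presheaf) (X := op U) τ τ' h
  obtain ⟨V, f, hf, hxV⟩ := this x hx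
  exact ⟨V, f.le, hxV, hf⟩

lemma smul_tensorSection {U : X.Opens} (r : Γ(X, U)) (s : Γ(M, U)) (t : Γ(N, U)) :
    r • tensorSection s t = tensorSection (r • s) t :=
  ((((PresheafOfModules.sheafificationAdjunction (structureMap X)).unit.app
    (presheafTensor M N)).app (op U)).hom.map_smul r (pureTensor s t)).symm

lemma pureTensor_smul {U : X.Opens} (r : Γ(X, U)) (s : Γ(M, U)) (t : Γ(N, U)) :
    pureTensor (r • s) t = pureTensor s (r • t) :=
  TensorProduct.smul_tmul (R := X.presheaf.obj (op U)) (M := (underlyingPresheaf M).obj (op U))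
        (N := (underlyingPresheaf N).obj (op U)) r s t

lemma tensorSection_smul {U : X.Opens} (r : Γ(X, U)) (s : Γ(M, U)) (t : Γ(N, U)) :
    tensorSection (r • s) t = tensorSection s (r • t) := by
  rw [← toTensor_pureTensor, pureTensor_smul, toTensor_pureTensor]

lemma res_tensorSection {V U : X.Opens} (h : V ≤ U) (s : Γ(M, U)) (t : Γ(N, U)) :
    res (tensor M N) h (tensorSection s t) = tensorSection (res M h s) (res N h t) := by
  rw [← toTensor_pureTensor, res_toTensor, preRes_pureTensor, toTensor_pureTensor]

end Tensor

/-! ### Local frames of tensor products -/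

section Frames

variable {X : Scheme.{u}} {M N : X.Modules}

lemma IsFrame.res {U V : X.Opens} {t : Γ(M, U)} (ht : IsFrame M t) (h : V ≤ U) :
    IsFrame M (res M h t) := by
  intro W hW
  have := ht W (hW.trans h)
  have e := res_res M h hW t
  simp only [FrobeniusSeshadri.res] at e ⊢
  rw [e]
  exact this

lemma IsFrame.bijective {U : X.Opens} {t : Γ(M, U)} (ht : IsFrame M t) :
    Function.Bijective fun r : Γ(X, U) ↦ r • t := by
  have := (isFrame_iff M t).1 ht U le_rfl
  rwa [res_self] at this

/-- Over an open set with a frame `t` of `M`, the presheaf tensor product is `t ⊗ N`. -/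
lemma bijective_pureTensor {U : X.Opens} {t : Γ(M, U)} (ht : IsFrame M t) :
    Function.Bijective fun n : Γ(N, U) ↦ pureTensor t n := by
  let A : Type u := X.presheaf.obj (op U)
  let e : A ≃ₗ[A] (underlyingPresheaf M).obj (op U) :=
    LinearEquiv.ofBijective (LinearMap.toSpanSingleton A ((underlyingPresheaf M).obj (op U)) t)
      ht.bijective
  let E := (TensorProduct.lid A ((underlyingPresheaf N).obj (op U))).symm.trans
    (TensorProduct.congr e (LinearEquiv.refl A ((underlyingPresheaf N).obj (op U))))
  have hE : ∀ n, E n = pureTensor t n := by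
    intro n
    have h1 : E n = TensorProduct.tmul A (e 1) n := rfl
    have h2 : e 1 = t := one_smul A (show (underlyingPresheaf M).obj (op U) from t)
    rw [h1, h2]
    rfl
  have : (fun n : Γ(N, U) ↦ pureTensor t n) = E := funext fun n ↦ (hE n).symm
  rw [this]
  exact E.bijective

/-- Tensoring with a local frame `t` of `M` identifies the sections of `N` with those of `M ⊗ N`:
over an open set with a frame, the presheaf tensor product is already a sheaf. -/
lemma bijective_tensorSection {U : X.Opens} {t : Γ(M, U)} (ht : IsFrame M t) :
    Function.Bijective fun n : Γ(N, U) ↦ tensorSection t n := by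
  -- Injectivity is needed on all smaller open sets, for the local preimages to glue.
  have inj : ∀ (V : X.Opens) (h : V ≤ U),
      Function.Injective fun n : Γ(N, V) ↦ tensorSection (res M h t) n := by
    intro V h n n' hn
    refine section_ext N fun x hx ↦ ?_
    obtain ⟨W, hW, hxW, e⟩ := exists_preRes_eq (pureTensor (res M h t) n)
      (pureTensor (res M h t) n') hn x hx
    refine ⟨W, hW, hxW, ?_⟩
    rw [preRes_pureTensor, preRes_pureTensor] at e
    exact (bijective_pureTensor ((ht.res h).res hW)).1 e
  refine ⟨by simpa only [res_self] using inj U le_rfl, fun σ ↦ ?_⟩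
  have loc : ∀ x : U, ∃ (V : X.Opens) (hV : V ≤ U), x.1 ∈ V ∧
      ∃ n : Γ(N, V), tensorSection (res M hV t) n = res (tensor M N) hV σ := by
    intro x
    obtain ⟨V, hV, hxV, τ, hτ⟩ := exists_toTensor_eq σ x.1 x.2
    obtain ⟨n, rfl⟩ := (bijective_pureTensor (ht.res hV)).2 τ
    exact ⟨V, hV, hxV, n, hτ⟩
  choose V hV hxV n hn using loc
  obtain ⟨ν, hν⟩ := exists_glue N V hV (fun x hx ↦ ⟨⟨x, hx⟩, hxV _⟩) n (by
    intro x y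
    apply inj (V x ⊓ V y) (inf_le_left.trans (hV x))
    have h1 := congrArg (res (tensor M N) (inf_le_left : V x ⊓ V y ≤ V x)) (hn x)
    have h2 := congrArg (res (tensor M N) (inf_le_right : V x ⊓ V y ≤ V y)) (hn y)
    rw [res_tensorSection, res_res, res_res] at h1 h2
    exact h1.trans h2.symm)
  refine ⟨ν, section_ext _ fun x hx ↦ ⟨V ⟨x, hx⟩, hV _, hxV ⟨x, hx⟩, ?_⟩⟩
  dsimp only
  rw [res_tensorSection, hν, hn]

lemma IsFrame.tensorSection {U : X.Opens} {t : Γ(M, U)} {t' : Γ(N, U)} (ht : IsFrame M t)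
    (ht' : IsFrame N t') : IsFrame (tensor M N) (tensorSection t t') := by
  rw [isFrame_iff]
  intro V hV
  have h := (bijective_tensorSection (N := N) (ht.res hV)).comp (ht'.res hV).bijective
  convert h using 2
  rw [res_tensorSection, smul_tensorSection, tensorSection_smul]
  rfl

/-- The section `1` of the structure sheaf. -/
def structureOne (U : X.Opens) : Γ(structureModule X, U) := (1 : Γ(X, U))

lemma isFrame_structureOne (U : X.Opens) : IsFrame (structureModule X) (structureOne U) := by
  intro V hV
  have : ∀ r : Γ(X, V), r • (structureModule X).presheaf.map (homOfLE hV).op (structureOne U) =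
      (r : Γ(X, V)) := by
    intro r
    have : (structureModule X).presheaf.map (homOfLE hV).op (structureOne U) =
      (resFun hV 1 : Γ(X, V)) := rfl
    rw [this, map_one]
    exact mul_one r
  simp_rw [this]
  exact Function.bijective_id

/-- The tensor power `t ^ n` of a section `t`. -/
def sectionPow {U : X.Opens} (t : Γ(M, U)) : (n : ℕ) → Γ(tensorPow M n, U)
  | 0 => structureOne U
  | n + 1 => FrobeniusSeshadri.tensorSection (sectionPow t n) t

lemma IsFrame.sectionPow {U : X.Opens} {t : Γ(M, U)} (ht : IsFrame M t) (n : ℕ) :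
    IsFrame (tensorPow M n) (sectionPow t n) := by
  induction n with
  | zero => exact isFrame_structureOne U
  | succ n ih => exact ih.tensorSection ht

lemma res_sectionPow {U V : X.Opens} (h : V ≤ U) (t : Γ(M, U)) (n : ℕ) :
    res (tensorPow M n) h (sectionPow t n) = sectionPow (res M h t) n := by
  induction n with
  | zero => exact map_one (resFun h)
  | succ n ih => exact (res_tensorSection h _ _).trans (by rw [ih]; rfl)

lemma sectionPow_smul {U : X.Opens} (r : Γ(X, U)) (t : Γ(M, U)) (n : ℕ) :
    sectionPow (r • t) n = r ^ n • sectionPow t n := by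
  induction n with
  | zero => rw [pow_zero, one_smul]; rfl
  | succ n ih =>
    change FrobeniusSeshadri.tensorSection (sectionPow (r • t) n) (r • t) =
      r ^ (n + 1) • FrobeniusSeshadri.tensorSection (sectionPow t n) t
    rw [ih, ← tensorSection_smul, smul_smul, smul_tensorSection, pow_succ']

end Frames

/-! ### Frobenius jets in local frames -/

section Quotient

variable {X : Scheme.{u}} (J : X.IdealSheafData)

/-- The section `1` of `𝒪_X / J` over an open set. -/
def quotOne (U : X.Opens) : Γ(quotientModule J, U) :=
  (1 : Γ(J.subscheme, J.subschemeι ⁻¹ᵁ U))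

lemma res_quotOne {U V : X.Opens} (h : V ≤ U) :
    res (quotientModule J) h (quotOne J U) = quotOne J V :=
  map_one (resFun (X := J.subscheme) (J.subschemeι.preimage_mono h))

lemma smul_quotOne {U : X.Opens} (r : Γ(X, U)) :
    r • quotOne J U = (J.subschemeι.app U r : Γ(J.subscheme, J.subschemeι ⁻¹ᵁ U)) :=
  mul_one (J.subschemeι.app U r : Γ(J.subscheme, J.subschemeι ⁻¹ᵁ U))

lemma smul_quotOne_surjective (U : X.affineOpens) :
    Function.Surjective fun r : Γ(X, U) ↦ r • quotOne J U.1 := by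
  simp_rw [smul_quotOne]
  exact J.subschemeι_app_surjective U

lemma smul_quotOne_eq_iff (U : X.affineOpens) (r r' : Γ(X, U)) :
    r • quotOne J U.1 = r' • quotOne J U.1 ↔ r - r' ∈ J.ideal U := by
  rw [smul_quotOne, smul_quotOne, ← J.ker_subschemeι_app, RingHom.sub_mem_ker_iff]
  rfl

lemma subsingleton_quotientModule (V : X.Opens)
    (h : ∀ x ∈ V, ∃ W : X.affineOpens, x ∈ W.1 ∧ W.1 ≤ V ∧ J.ideal W = ⊤) :
    Subsingleton Γ(quotientModule J, V) := by
  refine ⟨fun n n' ↦ section_ext _ fun x hx ↦ ?_⟩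
  obtain ⟨W, hxW, hWV, hJ⟩ := h x hx
  refine ⟨W, hWV, hxW, ?_⟩
  obtain ⟨r, hr⟩ := smul_quotOne_surjective J W (res _ hWV n)
  obtain ⟨r', hr'⟩ := smul_quotOne_surjective J W (res _ hWV n')
  rw [← hr, ← hr', smul_quotOne_eq_iff, hJ]
  trivial

lemma vanishingIdeal_ideal_eq_top (Z : Closeds X) (W : X.affineOpens)
    (h : ∀ x ∈ W.1, x ∉ Z) : (Scheme.IdealSheafData.vanishingIdeal Z).ideal W = ⊤ := by
  change PrimeSpectrum.vanishingIdeal (W.2.fromSpec ⁻¹' (Z : Set X)) = ⊤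
  have : W.2.fromSpec ⁻¹' (Z : Set X) = ∅ := by
    ext y
    simp only [Set.mem_preimage, Set.mem_empty_iff_false, iff_false]
    refine h _ ?_
    have : W.2.fromSpec y ∈ Set.range W.2.fromSpec := ⟨y, rfl⟩
    rwa [W.2.range_fromSpec] at this
  exact (congrArg PrimeSpectrum.vanishingIdeal this).trans PrimeSpectrum.vanishingIdeal_empty

lemma idealFrobPow_top {R : Type u} [CommRing R] (q : ℕ) :
    idealFrobPow (⊤ : Ideal R) q = ⊤ :=
  (Ideal.eq_top_iff_one _).2 (Ideal.subset_span ⟨1, trivial, one_pow q⟩)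

lemma subsingleton_quotientModule_frobPow (Z : Closeds X) (q : ℕ) (V : X.Opens)
    (h : ∀ x ∈ V, x ∉ Z) :
    Subsingleton Γ(quotientModule (frobPow (Scheme.IdealSheafData.vanishingIdeal Z) q), V) := by
  refine subsingleton_quotientModule _ V fun x hx ↦ ?_
  obtain ⟨_, ⟨W, hW, rfl⟩, hxW, hWV⟩ :=
    X.isBasis_affineOpens.exists_subset_of_mem_open (show x ∈ (V : Set X) from hx) V.isOpen
  refine ⟨⟨W, hW⟩, hxW, hWV, ?_⟩
  change idealFrobPow _ q = ⊤
  rw [vanishingIdeal_ideal_eq_top Z ⟨W, hW⟩ (fun y hy ↦ h y (hWV hy)), idealFrobPow_top]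

/-- Separation of Frobenius jets in terms of local frames `t x` of `A` on affine neighbourhoods
`U x` that meet `Z` at most in `x`: all prescribed classes modulo `I_Z^{[q]}` are the
coordinates of one global section. -/
theorem separatesFrobeniusJets_iff {A : X.Modules} {Z : Closeds X} {q : ℕ}
    (U : X → X.affineOpens) (hU : ∀ x, x ∈ (U x).1)
    (hUZ : ∀ x, ∀ z ∈ (U x).1, z ∈ Z → z = x)
    (t : ∀ x, Γ(A, (U x).1)) (ht : ∀ x, IsFrame A (t x)) :
    SeparatesFrobeniusJets A Z q ↔ ∀ a : ∀ x, Γ(X, (U x).1),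
      ∃ (s : Γ(A, ⊤)) (r : ∀ x, Γ(X, (U x).1)), (∀ x, res A le_top s = r x • t x) ∧
        ∀ x, r x - a x ∈
          idealFrobPow ((Scheme.IdealSheafData.vanishingIdeal Z).ideal (U x)) q := by
  set J := frobPow (Scheme.IdealSheafData.vanishingIdeal Z) q with hJ
  have key : ∀ (s : Γ(A, ⊤)) (r : ∀ x, Γ(X, (U x).1)), (∀ x, res A le_top s = r x • t x) →
      ∀ x, res (tensor A (quotientModule J)) (le_top : (U x).1 ≤ ⊤) (restrictionMap A J s) =
        tensorSection (t x) (r x • quotOne J (U x).1) := by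
    intro s r hr x
    rw [← tensorSection_smul, ← hr x, ← res_quotOne J (le_top : (U x).1 ≤ ⊤), ← res_tensorSection]
    rfl
  constructor
  · intro h a
    obtain ⟨σ, hσ⟩ := exists_glue (tensor A (quotientModule J)) (fun x ↦ (U x).1)
      (fun x ↦ (le_top : (U x).1 ≤ ⊤)) (fun x _ ↦ ⟨x, hU x⟩)
      (fun x ↦ tensorSection (t x) (a x • quotOne J (U x).1)) (by
        intro x y
        by_cases hxy : x = y
        · subst hxy; rfl
        -- `U x ∩ U y` does not meet `Z`, so `A ⊗ 𝒪_X / J` has only the zero section on it.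
        have : Subsingleton Γ(quotientModule J, (U x).1 ⊓ (U y).1) :=
          subsingleton_quotientModule_frobPow Z q _ fun z hz hzZ ↦
            hxy ((hUZ x z hz.1 hzZ).symm.trans (hUZ y z hz.2 hzZ))
        obtain ⟨n, hn⟩ := (bijective_tensorSection (N := quotientModule J)
          ((ht x).res inf_le_left)).2
            (res _ (inf_le_right : (U x).1 ⊓ (U y).1 ≤ (U y).1)
              (tensorSection (t y) (a y • quotOne J (U y).1)))
        rw [← hn, res_tensorSection]
        congr 1
        exact Subsingleton.elim _ _)
    obtain ⟨s, rfl⟩ := h σ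
    choose r hr using fun x ↦ (ht x).bijective.2 (res A le_top s)
    refine ⟨s, r, fun x ↦ (hr x).symm, fun x ↦ ?_⟩
    have := (key s r (fun x ↦ (hr x).symm) x).symm.trans (hσ x)
    exact (smul_quotOne_eq_iff J (U x) _ _).1 ((bijective_tensorSection (ht x)).1 this)
  · intro h σ
    choose n hn using fun x ↦ (bijective_tensorSection (N := quotientModule J) (ht x)).2
      (res _ le_top σ)
    choose a ha using fun x ↦ smul_quotOne_surjective J (U x) (n x)
    obtain ⟨s, r, hr, hra⟩ := h a
    refine ⟨s, section_ext _ fun x _ ↦ ⟨(U x).1, le_top, hU x, ?_⟩⟩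
    rw [key s r hr x, ← hn x, ← ha x]
    dsimp only
    rw [(smul_quotOne_eq_iff J (U x) _ _).2 (hra x)]

end Quotient

section Powers

variable {X : Scheme.{u}} {L : X.Modules}

/-- Description of global sections by transition functions: `r` is the family of coordinates of a
section of `L ^ n` in the frames `t i ^ n` exactly when `r i * g i j ^ n = r j` for all `i`, `j`. -/
theorem exists_section_iff {ι : Type u} (U : ι → X.Opens) (hU : ∀ x, ∃ i, x ∈ U i)
    (t : ∀ i, Γ(L, U i)) (ht : ∀ i, IsFrame L (t i)) (g : ∀ i j, Γ(X, U i ⊓ U j))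
    (hg : ∀ i j, g i j • res L inf_le_right (t j) = res L inf_le_left (t i)) (n : ℕ)
    (r : ∀ i, Γ(X, U i)) :
    (∃ s : Γ(tensorPow L n, ⊤), ∀ i, res _ le_top s = r i • sectionPow (t i) n) ↔
      ∀ i j, resFun (inf_le_left : U i ⊓ U j ≤ U i) (r i) * g i j ^ n =
        resFun (inf_le_right : U i ⊓ U j ≤ U j) (r j) := by
  have hl : ∀ i j, res (tensorPow L n) (inf_le_left : U i ⊓ U j ≤ U i)
      (r i • sectionPow (t i) n) =
        (resFun (inf_le_left : U i ⊓ U j ≤ U i) (r i) * g i j ^ n) •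
        sectionPow (res L (inf_le_right : U i ⊓ U j ≤ U j) (t j)) n := by
    intro i j
    rw [res_smul, res_sectionPow, ← hg, sectionPow_smul, smul_smul]
  have hr : ∀ i j, res (tensorPow L n) (inf_le_right : U i ⊓ U j ≤ U j)
      (r j • sectionPow (t j) n) = resFun (inf_le_right : U i ⊓ U j ≤ U j) (r j) •
        sectionPow (res L (inf_le_right : U i ⊓ U j ≤ U j) (t j)) n := by
    intro i j
    rw [res_smul, res_sectionPow]
  constructor
  · rintro ⟨s, hs⟩ i j
    apply (((ht j).res inf_le_right).sectionPow n).bijective.1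
    dsimp only
    rw [← hl, ← hr, ← hs, ← hs, res_res, res_res]
  · intro h
    refine exists_glue _ U (fun _ ↦ le_top) (fun x _ ↦ hU x) _ fun i j ↦ ?_
    rw [hl, hr, h]

end Powers

/-! ### Frobenius powers of ideals -/

section Algebra

/-- Frobenius powers of ideals commute with finite products of rings. -/
lemma mem_idealFrobPow_pi {ι : Type u} [Finite ι] {R : ι → Type u} [∀ i, CommRing (R i)]
    (I : ∀ i, Ideal (R i)) (q : ℕ) (b : ∀ i, R i) :
    b ∈ idealFrobPow (Ideal.pi I) q ↔ ∀ i, b i ∈ idealFrobPow (I i) q := by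
  classical
  constructor
  · intro hb i
    have h : idealFrobPow (Ideal.pi I) q ≤ (idealFrobPow (I i) q).comap (Pi.evalRingHom R i) := by
      rw [idealFrobPow, Ideal.span_le]
      rintro _ ⟨h, hh, rfl⟩
      exact Ideal.subset_span ⟨h i, hh i, rfl⟩
    exact h hb
  · intro hb
    have : Fintype ι := Fintype.ofFinite ι
    rw [← Finset.univ_sum_single b]
    refine Ideal.sum_mem _ fun i _ ↦ ?_
    obtain ⟨y, hy⟩ : ∃ y, y = b i := ⟨_, rfl⟩
    have hi := hb i
    rw [← hy] at hi ⊢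
    clear hy
    induction hi using Submodule.span_induction with
    | mem x hx =>
      obtain ⟨y, hy, rfl⟩ := hx
      have e : Pi.single i (y ^ q) = Pi.single i 1 * (Pi.single i y : ∀ i, R i) ^ q := by
        ext j
        by_cases hj : j = i
        · subst hj; simp
        · simp [hj]
      rw [e]
      exact Ideal.mul_mem_left _ _ (Ideal.subset_span ⟨_, Ideal.single_mem_pi hy, rfl⟩)
    | zero => rw [Pi.single_zero]; exact Ideal.zero_mem _
    | add x y _ _ hx hy => rw [Pi.single_add]; exact Ideal.add_mem _ hx hy
    | smul c x _ hx => rw [smul_eq_mul, Pi.single_mul]; exact Ideal.mul_mem_left _ _ hx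

lemma pow_mem_idealFrobPow_mul {R : Type u} [CommRing R] {I : Ideal R} {q Q : ℕ}
    (hQ : ∀ a b : R, (a + b) ^ Q = a ^ Q + b ^ Q) {h : R} (hh : h ∈ idealFrobPow I q) :
    h ^ Q ∈ idealFrobPow I (q * Q) := by
  induction hh using Submodule.span_induction with
  | mem x hx =>
    obtain ⟨y, hy, rfl⟩ := hx
    exact Ideal.subset_span ⟨y, hy, pow_mul y q Q⟩
  | zero =>
    have : (0 : R) ^ Q = 0 := by simpa using hQ 0 0
    rw [this]
    exact Ideal.zero_mem _
  | add x y _ _ hx hy => rw [hQ]; exact Ideal.add_mem _ hx hy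
  | smul c x _ hx => rw [smul_eq_mul, mul_pow]; exact Ideal.mul_mem_left _ _ hx

/-- If `S` maps onto `R / I^{[q]}` and `T` onto `R / I^{[Q]}`, then the additive group generated
by the products `s ^ Q * t` maps onto `R / I^{[q Q]}`. The `I`-adic filtration, which is finite
modulo `I^{[q]}`, reduces this to elements `g * h ^ Q` with `h` in ever higher powers of `I`. -/
theorem exists_sub_mem_idealFrobPow_mul {R : Type u} [CommRing R] {I : Ideal R} {q Q : ℕ}
    (hI : ∃ N, I ^ N ≤ idealFrobPow I q) (hQ : ∀ a b : R, (a + b) ^ Q = a ^ Q + b ^ Q)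
    (S T : Set R) (W : AddSubgroup R) (hS : ∀ a, ∃ s ∈ S, s - a ∈ idealFrobPow I q)
    (hT : ∀ a, ∃ t ∈ T, t - a ∈ idealFrobPow I Q) (hW : ∀ s ∈ S, ∀ t ∈ T, s ^ Q * t ∈ W)
    (a : R) : ∃ w ∈ W, w - a ∈ idealFrobPow I (q * Q) := by
  obtain ⟨N, hN⟩ := hI
  let W' : AddSubgroup R := W ⊔ (idealFrobPow I (q * Q)).toAddSubgroup
  have hJ : ∀ x ∈ idealFrobPow I (q * Q), x ∈ W' :=
    fun x hx ↦ (le_sup_right : _ ≤ W') hx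
  -- Descending induction on the exponent `i`; nothing is left to prove once `N ≤ i`.
  have key : ∀ k i, N ≤ i + k → ∀ h ∈ I ^ i, ∀ g, g * h ^ Q ∈ W' := by
    intro k
    induction k with
    | zero =>
      intro i hi h hh g
      exact hJ _ (Ideal.mul_mem_left _ _
        (pow_mem_idealFrobPow_mul hQ (hN (Ideal.pow_le_pow_right hi hh))))
    | succ k ih =>
      intro i hi h hh g
      obtain ⟨t, ht, htg⟩ := hT g
      obtain ⟨s, hs, hsh⟩ := hS h
      -- A term `d * h ^ Q` with `d ∈ I^{[Q]}` is a combination of `Q`-th powers of elements of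
      -- `I ^ (i + 1)`.
      have h1 : ∀ d ∈ idealFrobPow I Q, ∀ c, c * d * h ^ Q ∈ W' := by
        intro d hd
        induction hd using Submodule.span_induction with
        | mem x hx =>
          obtain ⟨y, hy, rfl⟩ := hx
          intro c
          have := ih (i + 1) (by omega) (h * y) (pow_succ I i ▸ Ideal.mul_mem_mul hh hy) c
          convert this using 1
          ring
        | zero => intro c; simp
        | add x y _ _ hx hy =>
          intro c
          rw [mul_add, add_mul]
          exact W'.add_mem (hx c) (hy c)
        | smul b x _ hx =>
          intro c
          rw [smul_eq_mul, ← mul_assoc]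
          exact hx (c * b)
      have h2 : s ^ Q = h ^ Q + (s - h) ^ Q := by rw [← hQ]; congr 1; ring
      have h3 : g * h ^ Q = s ^ Q * t - t * (s - h) ^ Q - 1 * (t - g) * h ^ Q := by
        rw [h2]; ring
      rw [h3]
      exact W'.sub_mem (W'.sub_mem ((le_sup_left : W ≤ W') (hW s hs t ht))
        (hJ _ (Ideal.mul_mem_left _ _ (pow_mem_idealFrobPow_mul hQ hsh)))) (h1 _ htg 1)
  have ha : a ∈ W' := by
    have := key N 0 (by omega) 1 (by simp) a
    rwa [one_pow, mul_one] at this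
  obtain ⟨w, hw, j, hj, rfl⟩ := AddSubgroup.mem_sup.1 ha
  refine ⟨w, hw, ?_⟩
  have : w - (w + j) = -j := by ring
  rw [this]
  exact neg_mem hj

end Algebra

/-! ### Products of sections -/

section Cocycle

variable {X : Scheme.{u}} {L : X.Modules}

/-- The families of functions satisfying the transition rule of the `n`-th power of the cocycle
`g`; for `g` the cocycle of a line bundle `L` these are the global sections of `L ^ n`. -/
def cocycleSections {ι : Type u} (U : ι → X.Opens) (g : ∀ i j, Γ(X, U i ⊓ U j)) (n : ℕ) :
    AddSubgroup (∀ i, Γ(X, U i)) where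
  carrier := {r | ∀ i j, resFun (inf_le_left : U i ⊓ U j ≤ U i) (r i) * g i j ^ n =
    resFun (inf_le_right : U i ⊓ U j ≤ U j) (r j)}
  zero_mem' i j := by simp
  add_mem' {r r'} h h' i j := by
    rw [Pi.add_apply, Pi.add_apply, map_add, map_add, add_mul, h, h']
  neg_mem' {r} h i j := by
    rw [Pi.neg_apply, Pi.neg_apply, map_neg, map_neg, neg_mul, h]

lemma mul_mem_cocycleSections {ι : Type u} {U : ι → X.Opens} {g : ∀ i j, Γ(X, U i ⊓ U j)}
    {m n : ℕ} {r r' : ∀ i, Γ(X, U i)} (hr : r ∈ cocycleSections U g m)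
    (hr' : r' ∈ cocycleSections U g n) : r * r' ∈ cocycleSections U g (m + n) := by
  intro i j
  rw [Pi.mul_apply, Pi.mul_apply, map_mul, map_mul, ← hr i j, ← hr' i j]
  ring

lemma pow_mem_cocycleSections {ι : Type u} {U : ι → X.Opens} {g : ∀ i j, Γ(X, U i ⊓ U j)}
    {m : ℕ} {r : ∀ i, Γ(X, U i)} (hr : r ∈ cocycleSections U g m) (Q : ℕ) :
    r ^ Q ∈ cocycleSections U g (m * Q) := by
  intro i j
  rw [Pi.pow_apply, Pi.pow_apply, map_pow, map_pow, ← hr i j]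
  ring

/-- Restriction of a family of functions indexed by the points of `X` to the points of `Z`. -/
def restrictFamily (Z : Closeds X) (U : X → X.Opens) :
    (∀ x, Γ(X, U x)) →+* ∀ z : Z, Γ(X, U z.1) :=
  RingHom.pi fun z ↦ Pi.evalRingHom _ z.1

/-- The ideal of `Z` in the product of the rings `𝒪_X(U z)`, for `z` in `Z`. -/
def idealAt (Z : Closeds X) (U : X → X.affineOpens) : Ideal (∀ z : Z, Γ(X, (U z.1).1)) :=
  Ideal.pi fun z ↦ (Scheme.IdealSheafData.vanishingIdeal Z).ideal (U z.1)

/-- `L ^ n` separates `q`-jets at `Z` exactly when its global sections, written as families of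
functions in the frames `t x ^ n`, map onto the product over `z` in `Z` of the rings
`𝒪_X(U z)`, modulo the Frobenius power of the ideal of `Z`. -/
theorem separatesFrobeniusJets_tensorPow_iff {Z : Closeds X} [Finite Z] {q : ℕ}
    (U : X → X.affineOpens) (hU : ∀ x, x ∈ (U x).1)
    (hUZ : ∀ x, ∀ z ∈ (U x).1, z ∈ Z → z = x)
    (t : ∀ x, Γ(L, (U x).1)) (ht : ∀ x, IsFrame L (t x))
    (g : ∀ i j, Γ(X, (U i).1 ⊓ (U j).1))
    (hg : ∀ i j, g i j • res L inf_le_right (t j) = res L inf_le_left (t i)) (n : ℕ) :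
    SeparatesFrobeniusJets (tensorPow L n) Z q ↔ ∀ a : ∀ z : Z, Γ(X, (U z.1).1),
      ∃ r ∈ (cocycleSections (fun x ↦ (U x).1) g n).map
        (restrictFamily Z fun x ↦ (U x).1).toAddMonoidHom,
        r - a ∈ idealFrobPow (idealAt Z U) q := by
  classical
  rw [separatesFrobeniusJets_iff U hU hUZ (fun x ↦ sectionPow (t x) n)
    (fun x ↦ (ht x).sectionPow n)]
  constructor
  · intro h a
    obtain ⟨s, r, hs, hr⟩ := h fun x ↦ if hx : x ∈ Z then a ⟨x, hx⟩ else 0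
    refine ⟨_, ⟨r, (exists_section_iff _ (fun x ↦ ⟨x, hU x⟩) t ht g hg n r).1 ⟨s, hs⟩, rfl⟩, ?_⟩
    refine (mem_idealFrobPow_pi _ q _).2 fun z ↦ ?_
    have := hr z.1
    rwa [dif_pos z.2] at this
  · intro h a
    obtain ⟨_, ⟨r, hr, rfl⟩, hra⟩ := h (restrictFamily Z (fun x ↦ (U x).1) a)
    obtain ⟨s, hs⟩ := (exists_section_iff _ (fun x ↦ ⟨x, hU x⟩) t ht g hg n r).2 hr
    refine ⟨s, r, hs, fun x ↦ ?_⟩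
    by_cases hx : x ∈ Z
    · exact (mem_idealFrobPow_pi _ q _).1 hra ⟨x, hx⟩
    · rw [vanishingIdeal_ideal_eq_top Z (U x)
        (fun z hz hzZ ↦ hx (hUZ x z hz hzZ ▸ hzZ)), idealFrobPow_top]
      trivial

lemma exists_pow_le_idealFrobPow {R : Type u} [CommRing R] [IsNoetherianRing R] (I : Ideal R)
    (q : ℕ) : ∃ N, I ^ N ≤ idealFrobPow I q := by
  refine Ideal.exists_pow_le_of_le_radical_of_fg ?_ (IsNoetherian.noetherian I)
  exact fun x hx ↦ ⟨q, Ideal.subset_span ⟨x, hx, rfl⟩⟩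

/-- Smoothness makes `X` of finite presentation over `k` near the points of `Z`, so that the ideal
of `Z` is finitely generated there. -/
lemma isNoetherianRing_of_smooth {k : Type u} [Field k] (f : X ⟶ Spec (CommRingCat.of k))
    (V : X.Opens) [Smooth (V.ι ≫ f)] (U : X.affineOpens) (h : U.1 ≤ V) :
    IsNoetherianRing Γ(X, U.1) := by
  have : IsLocallyNoetherian V.toScheme := LocallyOfFiniteType.isLocallyNoetherian (V.ι ≫ f)
  have : IsLocallyNoetherian U.1.toScheme :=
    isLocallyNoetherian_of_isOpenImmersion (X.homOfLE h)
  have : IsAffine U.1.toScheme := U.2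
  have := IsLocallyNoetherian.component_noetherian (X := U.1.toScheme)
    ⟨⊤, isAffineOpen_top U.1.toScheme⟩
  exact isNoetherianRing_of_ringEquiv _ (U.1.topIso).commRingCatIsoToRingEquiv

lemma charP_of_mem {k : Type u} [Field k] (p : ℕ) [CharP k p] (f : X ⟶ Spec (CommRingCat.of k))
    (U : X.Opens) (x : X) (hx : x ∈ U) : CharP Γ(X, U) p := by
  have : Nonempty U := ⟨⟨x, hx⟩⟩
  have : Nontrivial Γ(X, U) := inferInstance
  let φ : k →+* Γ(X, U) := (resFun (le_top : U ≤ ⊤)).comp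
    (f.appTop.hom.comp (Scheme.ΓSpecIso (CommRingCat.of k)).inv.hom)
  exact charP_of_injective_ringHom φ.injective p

/-- Separated jets multiply: from `q`-jets separated by `L ^ m` and `Q`-jets separated by `L ^ n`,
the sections `s ^ Q * t` show that `L ^ (m * Q + n)` separates `q * Q`-jets. -/
theorem SeparatesFrobeniusJets.mul {k : Type u} [Field k] (p : ℕ) [Fact p.Prime] [CharP k p]
    (f : X ⟶ Spec (CommRingCat.of k)) (hL : IsLineBundle L) {Z : Closeds X}
    (hZfin : (Z : Set X).Finite) (hZclosed : ∀ x ∈ Z, IsClosed ({x} : Set X))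
    (hZsmooth : ∀ x ∈ Z, IsSmoothAt f x) {m n q i : ℕ}
    (hm : SeparatesFrobeniusJets (tensorPow L m) Z q)
    (hn : SeparatesFrobeniusJets (tensorPow L n) Z (p ^ i)) :
    SeparatesFrobeniusJets (tensorPow L (m * p ^ i + n)) Z (q * p ^ i) := by
  classical
  have : Finite Z := hZfin
  -- Each point has an affine neighbourhood that trivializes `L` and avoids the other points of `Z`.
  have nbhd : ∀ x : X, ∃ (U : X.affineOpens) (t : Γ(L, U.1)), x ∈ U.1 ∧ IsFrame L t ∧
      (∀ z ∈ U.1, z ∈ Z → z = x) ∧ (x ∈ Z → IsNoetherianRing Γ(X, U.1)) := by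
    intro x
    obtain ⟨V, t, hxV, ht⟩ := hL x
    obtain ⟨V', hxV', hV'⟩ : ∃ V' : X.Opens, x ∈ V' ∧ (x ∈ Z → Smooth (V'.ι ≫ f)) := by
      by_cases hx : x ∈ Z
      · obtain ⟨V', hxV', hs⟩ := hZsmooth x hx
        exact ⟨V', hxV', fun _ ↦ hs⟩
      · exact ⟨⊤, trivial, fun h ↦ absurd h hx⟩
    have hcl : IsClosed ((Z : Set X) \ {x}) := by
      rw [← Set.biUnion_of_singleton ((Z : Set X) \ {x})]
      exact (hZfin.subset Set.sdiff_subset).isClosed_biUnion fun z hz ↦ hZclosed z hz.1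
    let V'' : X.Opens := ⟨_, hcl.isOpen_compl⟩
    obtain ⟨_, ⟨U, hU, rfl⟩, hxU, hUV⟩ :=
      X.isBasis_affineOpens.exists_subset_of_mem_open
        (show x ∈ ((V ⊓ V' ⊓ V'' : X.Opens) : Set X) from ⟨⟨hxV, hxV'⟩, fun h ↦ h.2 rfl⟩)
        (V ⊓ V' ⊓ V'').isOpen
    have h1 : U ≤ V := fun y hy ↦ (hUV hy).1.1
    have h2 : U ≤ V' := fun y hy ↦ (hUV hy).1.2
    refine ⟨⟨U, hU⟩, res L h1 t, hxU, ht.res h1, fun z hz hzZ ↦ ?_, fun hx ↦ ?_⟩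
    · by_contra hzx
      exact (hUV hz).2 ⟨hzZ, hzx⟩
    · have := hV' hx
      exact isNoetherianRing_of_smooth f V' ⟨U, hU⟩ h2
  choose U t hU ht hUZ hN using nbhd
  choose g hg using fun x y ↦ ((ht y).res (inf_le_right : (U x).1 ⊓ (U y).1 ≤ (U y).1)).bijective.2
    (res L inf_le_left (t x))
  have : ∀ z : Z, IsNoetherianRing Γ(X, (U z.1).1) := fun z ↦ hN z.1 z.2
  rw [separatesFrobeniusJets_tensorPow_iff U hU hUZ t ht g hg] at hm hn ⊢
  refine exists_sub_mem_idealFrobPow_mul (exists_pow_le_idealFrobPow _ _) ?_ _ _ _ hm hn ?_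
  · -- The product ring may be zero, so characteristic `p` is used one factor at a time.
    intro a b
    ext z
    have := charP_of_mem p f (U z.1).1 z.1 (hU z.1)
    exact add_pow_char_pow (a z) (b z) p i
  · rintro _ ⟨s, hs, rfl⟩ _ ⟨s', hs', rfl⟩
    refine ⟨s ^ p ^ i * s',
      mul_mem_cocycleSections (pow_mem_cocycleSections hs _) hs', ?_⟩
    exact (map_mul (restrictFamily Z fun x ↦ (U x).1) _ _).trans (by rw [map_pow]; rfl)

lemma exists_mem_of_frobeniusJetOrder_eq {p : ℕ} {A : X.Modules} {Z : Closeds X} {e : ℕ}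
    (he : frobeniusJetOrder p A Z = e) (he1 : 1 ≤ e) : SeparatesFrobeniusJets A Z (p ^ e) := by
  by_contra hsep
  -- Otherwise every admissible exponent is at most `e - 1`.
  have h : frobeniusJetOrder p A Z ≤ ((e - 1 : ℕ) : ℕ∞) := by
    refine iSup₂_le fun i hi ↦ ?_
    have h1 : (i : ℕ∞) ≤ e := he ▸ le_iSup₂ (f := fun (i : ℕ)
      (_ : i ∈ {e : ℕ | 1 ≤ e ∧ SeparatesFrobeniusJets A Z (p ^ e)}) ↦ (i : ℕ∞)) i hi
    have h2 : i ≠ e := fun h ↦ hsep (h ▸ hi.2)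
    have h3 : i ≤ e := by exact_mod_cast h1
    exact_mod_cast (show i ≤ e - 1 by omega)
  rw [he] at h
  have : e ≤ e - 1 := by exact_mod_cast h
  omega

/-- The induction starts at one summand, since separation of `p ^ 0`-jets by the structure sheaf
fails as soon as `Z` has two points of a connected projective variety. -/
theorem separatesFrobeniusJets_tensorPow_geomSum {k : Type u} [Field k] (p : ℕ) [Fact p.Prime]
    [CharP k p] {X : Scheme.{u}} (f : X ⟶ Spec (CommRingCat.of k))
    {L : X.Modules} (hL : IsLineBundle L) {Z : Closeds X}
    (hZfin : (Z : Set X).Finite) (hZclosed : ∀ x ∈ Z, IsClosed ({x} : Set X))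
    (hZsmooth : ∀ x ∈ Z, IsSmoothAt f x) {m e : ℕ}
    (h : SeparatesFrobeniusJets (tensorPow L m) Z (p ^ e)) (r : ℕ) :
    SeparatesFrobeniusJets (tensorPow L (m * ∑ i ∈ Finset.range (r + 1), (p ^ e) ^ i)) Z
      (p ^ ((r + 1) * e)) := by
  induction r with
  | zero => simpa using h
  | succ r ih =>
    have := SeparatesFrobeniusJets.mul p f hL hZfin hZclosed hZsmooth h ih
    rw [Finset.sum_range_succ, mul_add, add_comm (m * _), ← pow_mul, mul_comm e,
      add_mul (r + 1), one_mul, add_comm _ e, pow_add]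
    exact this

end Cocycle

end FrobeniusSeshadri

end

theorem lemma2p2 {k : Type u} [Field k] [IsAlgClosed k] (p : ℕ) [Fact p.Prime] [CharP k p]
    {X : Scheme.{u}} [IsIntegral X] (f : X ⟶ Spec (CommRingCat.of k))
    (hX : FrobeniusSeshadri.IsProjective f)
    (L : X.Modules) (hL : FrobeniusSeshadri.IsLineBundle L)
    (hample : FrobeniusSeshadri.IsAmple L)
    (Z : Closeds X) (hZfin : (Z : Set X).Finite)
    (hZclosed : ∀ x ∈ Z, IsClosed ({x} : Set X))
    (hZsmooth : ∀ x ∈ Z, FrobeniusSeshadri.IsSmoothAt f x)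
    (m e r : ℕ) (hm : 1 ≤ m) (hr : 1 ≤ r)
    (he : FrobeniusSeshadri.frobeniusJetOrder p (FrobeniusSeshadri.tensorPow L m) Z = (e : ℕ∞)) :
    ((r * e : ℕ) : ℕ∞) ≤ FrobeniusSeshadri.frobeniusJetOrder p
        (FrobeniusSeshadri.tensorPow L (m * ((p ^ (r * e) - 1) / (p ^ e - 1)))) Z ∧
      (1 ≤ e → FrobeniusSeshadri.SeparatesFrobeniusJets
        (FrobeniusSeshadri.tensorPow L (m * ((p ^ (r * e) - 1) / (p ^ e - 1)))) Z
        (p ^ (r * e))) := by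
  have sep : 1 ≤ e → FrobeniusSeshadri.SeparatesFrobeniusJets
      (FrobeniusSeshadri.tensorPow L (m * ((p ^ (r * e) - 1) / (p ^ e - 1)))) Z
        (p ^ (r * e)) := by
    intro he1
    have hp : 2 ≤ p := (Fact.out : p.Prime).two_le
    obtain ⟨r, rfl⟩ := Nat.exists_eq_add_of_le' hr
    have h := FrobeniusSeshadri.separatesFrobeniusJets_tensorPow_geomSum p f hL hZfin hZclosed
      hZsmooth
      (FrobeniusSeshadri.exists_mem_of_frobeniusJetOrder_eq he he1) r
    rwa [Nat.geomSum_eq (hp.trans (Nat.le_self_pow (by omega) p)), ← pow_mul,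
      mul_comm e (r + 1)] at h
  refine ⟨?_, sep⟩
  rcases Nat.eq_zero_or_pos e with rfl | he1
  · simp
  · exact le_iSup₂ (f := fun (i : ℕ) (_ : i ∈ {i : ℕ | 1 ≤ i ∧
      FrobeniusSeshadri.SeparatesFrobeniusJets
        (FrobeniusSeshadri.tensorPow L (m * ((p ^ (r * e) - 1) / (p ^ e - 1)))) Z (p ^ i)}) ↦
        (i : ℕ∞)) (r * e) ⟨Nat.mul_pos hr he1, sep he1⟩
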